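/- Let $\ell^2$ be the Hilbert space of square summable complex sequences $x=(x_0,x_1,\dots)$ with standard basis $(e_i)_{i\ge 0}$, let $P_k x=(x_0,\dots,x_k,0,0,\dots)$ for $k\ge 0$, and put $P_{-1}=0$. A bounded operator $A$ on $\ell^2$ is causal if $P_kAP_k=P_kA$ for all $k$; the causal operators form the nest algebra $\mathcal B_c(\ell^2,\ell^2)$ of lower triangular operators. A partial isometry $U\in\mathcal B_c(\ell^2,\ell^2)$ is inner if $U^*U$ commutes with every $I-P_n$, and co-inner if $UU^*$ does. An operator $A\in\mathcal B_c(\ell^2,\ell^2)$ is outer if the orthogonal projection onto the closure of its range commutes with every $I-P_n$ and $A(I-P_n)\ell^2$ is dense in $(I-P_n)\ell^2\cap A\ell^2$ for every $n\ge -1$. Let $T_1,T_2,T_3\in\mathcal B_c(\ell^2,\ell^2)$ with factorizations $T_2=T_{2i}T_{2o}$ and $T_3=T_{3o}T_{3ci}$, where $T_{2i}$ is inner, $T_{3ci}$ is inner or co-inner, and $T_{2o},T_{3o}$ are outer. Assume (A1) $T_{2o}$ and $T_{3o}$ are invertible in $\mathcal B_c(\ell^2,\ell^2)$, that is, they have causal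 bounded inverses. For a bounded operator $T$ let $\|T\|_1=\sum_i\langle (T^*T)^{1/2}e_i,e_i\rangle\in[0,\infty]$, let $\mathcal C_1=\{T:\|T\|_1<\infty\}$ be the trace class, let $\operatorname{tr}(T)=\sum_i\langle Te_i,e_i\rangle$, and let $$S=\{T\in\mathcal C_1:\ P_{n+1}\,T\,(I-P_n)=0\ \text{ for all } n\ge -1\},$$ the space of strictly causal (strictly lower triangular) trace class operators, which is the preannihilator of $\mathcal B_c(\ell^2,\ell^2)$ in $\mathcal C_1$ under the pairing $(A,T)\mapsto\operatorname{tr}(AT)$. **Theorem 1.** Let $\mu=\inf_{Q\in\mathcal B_c(\ell^2,\ell^2)}\|T_{2i}^*T_1T_{3ci}^*-Q\|$. Then there is at least one $Q_o\in\mathcal B_c(\ell^2,\ell^2)$ that attains the infimum, and $$\mu=\|T_{2i}^*T_1T_{3ci}^*-Q_o\|=\sup_{T\in S,\ \|T\|_1\le 1}\bigl|\operatorname{tr}(T\,T_{2i}^*T_1T_{3ci}^*)\bigr|,$$ where the series defining $\operatorname{tr}(T\,T_{2i}^*T_1T_{3ci}^*)$ converges absolutely for every $T\in S$. -/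

import Mathlib

open scoped ENNReal InnerProductSpace lp

noncomputable section

namespace LTV

/-- The Hilbert space `ℓ²` of square summable complex sequences `(x₀, x₁, x₂, …)`. -/
abbrev L2 : Type := lp (fun _ : ℕ => ℂ) 2

/-- The Banach algebra `B(ℓ², ℓ²)`; its multiplication is composition. -/
abbrev Op : Type := L2 →L[ℂ] L2

/-- The standard orthonormal basis of `ℓ²`. -/
def e (i : ℕ) : L2 := lp.single 2 i (1 : ℂ)

/-- Truncation to the first `n` coordinates: `cut n x = (x₀, …, x_{n-1}, 0, 0, …)`.
In terms of the truncations `P_k x = (x₀, …, x_k, 0, …)`, with `P_{-1} = 0`, this is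
`cut n = P_{n-1}`, so that `n = 0, 1, 2, …` corresponds to `k = -1, 0, 1, …`. -/
def cut (n : ℕ) : Op := ∑ i ∈ Finset.range n, (innerSL ℂ (e i)).smulRight (e i)

theorem cut_apply (n : ℕ) (x : L2) (j : ℕ) : cut n x j = if j < n then x j else 0 := by
  have h : cut n x = ∑ i ∈ Finset.range n, x i • e i := by
    simp [cut, e, lp.inner_single_left]
  rw [h, lp.coeFn_sum, Finset.sum_apply]
  simp [e, lp.single_apply, Pi.single_apply]

/-- The orthogonal projection `I - P_{n-1}` onto `{x | x₀ = … = x_{n-1} = 0}`. The ranges of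
these projections, together with `{0}`, form the nest of `ℓ²`. -/
def tail (n : ℕ) : Op := 1 - cut n

/-- The nest algebra `B_c(ℓ², ℓ²)` of causal (lower triangular) operators. -/
def causal : Set Op := {A | ∀ n : ℕ, cut n * A * cut n = cut n * A}

/-- A partial isometry preserves the norm on the orthogonal complement of its kernel. -/
def IsPartialIsometry (U : Op) : Prop :=
  ∀ u ∈ (LinearMap.ker (U : L2 →ₗ[ℂ] L2))ᗮ, ‖U u‖ = ‖u‖

/-- Inner operators: causal partial isometries `U` such that `U* U` commutes with the nest. -/
def IsInner (U : Op) : Prop :=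
  U ∈ causal ∧ IsPartialIsometry U ∧
    ∀ n : ℕ, Commute (ContinuousLinearMap.adjoint U * U) (tail n)

/-- Co-inner operators: causal partial isometries `U` such that `U U*` commutes with the nest. -/
def IsCoinner (U : Op) : Prop :=
  U ∈ causal ∧ IsPartialIsometry U ∧
    ∀ n : ℕ, Commute (U * ContinuousLinearMap.adjoint U) (tail n)

/-- Outer operators: causal operators `A` whose range projection commutes with the nest and
which map each `N` in the nest densely into `N ∩ A ℓ²`. -/
def IsOuter (A : Op) : Prop :=
  A ∈ causal ∧
    (∀ n : ℕ, Commute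
      (LinearMap.range (A : L2 →ₗ[ℂ] L2)).topologicalClosure.starProjection (tail n)) ∧
    ∀ n : ℕ, Set.range (tail n) ∩ Set.range A ⊆ closure (A '' Set.range (tail n))

/-- Invertibility inside the algebra of causal operators. -/
def IsCausallyInvertible (A : Op) : Prop :=
  A ∈ causal ∧ ∃ R ∈ causal, R * A = 1 ∧ A * R = 1

/-- The modulus `|T| = (T* T)^{1/2}` of a bounded operator on a complex Hilbert space. -/
def modulus {H : Type*} [NormedAddCommGroup H] [InnerProductSpace ℂ H] [CompleteSpace H]
    (T : H →L[ℂ] H) : H →L[ℂ] H := CFC.sqrt (ContinuousLinearMap.adjoint T * T)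

/-- The trace norm `‖T‖₁ = tr |T| = ∑ᵢ ⟨|T| eᵢ, eᵢ⟩`, as an element of `[0, ∞]`. -/
def traceNorm (T : Op) : ℝ≥0∞ :=
  ∑' i : ℕ, ENNReal.ofReal (⟪e i, modulus T (e i)⟫_ℂ).re

/-- The trace class `C₁`: the operators of finite trace norm. -/
def traceClass : Set Op := {T | traceNorm T < ⊤}

/-- The trace `∑ᵢ ⟨T eᵢ, eᵢ⟩` (the inner product of Mathlib is linear in the second slot). -/
def tr (T : Op) : ℂ := ∑' i : ℕ, ⟪e i, T (e i)⟫_ℂ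

/-- The subspace `S` of `C₁`, the preannihilator of the causal operators under the pairing
`(A, T) ↦ tr (A T)`: the strictly causal (strictly lower triangular) trace class operators,
`P_n T (I - P_{n-1}) = 0` for `n = 0, 1, 2, …`. -/
def S : Set Op := {T | T ∈ traceClass ∧ ∀ n : ℕ, cut (n + 1) * T * tail n = 0}

end LTV

end

/-! Write `B` for the operator to be approximated. For `T ∈ S` and causal `Q` the product `T * Q`
has zero diagonal, so `tr (T * B) = tr (T * (B - Q))`, and the trace norm inequality bounds every
dual value by every `‖B - Q‖`.

Conversely, a rank one operator sending the range of `cut n` into that of `tail n` lies in `S`.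
Testing on these (`norm_cut_mul_tail_le`) shows that any bound for the dual values bounds all
corners `cut n * B * tail n`. Arveson's distance formula (`exists_mem_causal_norm_sub_le`) turns a
bound on the corners into a causal `Q` at no greater distance. This closes the duality gap and gives
attainment at once. The formula is proved constructively: the part of `B` strictly above the
diagonal is completed row by row without increasing the norm. -/

open ContinuousLinearMap

/-! ### Contractive factorization and row completion in Hilbert space -/

section Hilbert

variable {H : Type*} [NormedAddCommGroup H] [InnerProductSpace ℂ H]

theorem ContinuousLinearMap.mul_apply_apply (A C : H →L[ℂ] H) (x : H) :
    (A * C) x = A (C x) := rfl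

variable [CompleteSpace H]

/-- Douglas factorization through a contraction. -/
theorem ContinuousLinearMap.exists_contraction_mul_eq {A C : H →L[ℂ] H}
    (h : ∀ x, ‖A x‖ ≤ ‖C x‖) : ∃ V : H →L[ℂ] H, ‖V‖ ≤ 1 ∧ V * C = A := by
  let K := (LinearMap.range (C : H →ₗ[ℂ] H)).topologicalClosure
  have hmem : ∀ x, C x ∈ K := fun x => Submodule.le_topologicalClosure _ ⟨x, rfl⟩
  let c : H →ₗ[ℂ] K := (C : H →ₗ[ℂ] H).codRestrict K hmem
  have hc : DenseRange c := by
    intro y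
    rw [Metric.mem_closure_iff]
    intro ε hε
    have hy : (y : H) ∈ closure (LinearMap.range (C : H →ₗ[ℂ] H) : Set H) := y.2
    obtain ⟨_, ⟨x, rfl⟩, hx⟩ := Metric.mem_closure_iff.1 hy ε hε
    exact ⟨c x, ⟨x, rfl⟩, hx⟩
  have hA : ∀ x, ‖(A : H →ₗ[ℂ] H) x‖ ≤ 1 * ‖c x‖ := fun x => by rw [one_mul]; exact h x
  -- `V` extends `C x ↦ A x` by continuity to the closed range of `C` and vanishes on its
  -- complement.
  refine ⟨((A : H →ₗ[ℂ] H).extendOfNorm c).comp K.orthogonalProjectionOnto, ?_, ?_⟩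
  · refine opNorm_le_bound _ zero_le_one fun x => ?_
    refine (LinearMap.norm_extendOfNorm_apply_le hc 1 hA _).trans ?_
    gcongr
    exact K.norm_orthogonalProjectionOnto_apply_le x
  · ext x
    have : K.orthogonalProjectionOnto (C x) = c x :=
      K.orthogonalProjectionOnto_mem_subspace_eq_self (c x)
    rw [mul_apply_apply, comp_apply, this]
    exact LinearMap.extendOfNorm_eq hc ⟨1, hA⟩ x

theorem ContinuousLinearMap.inner_sqrt_self {A : H →L[ℂ] H} (hA : 0 ≤ A) (x : H) :
    ((‖CFC.sqrt A x‖ ^ 2 : ℝ) : ℂ) = ⟪x, A x⟫_ℂ := by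
  have hs : adjoint (CFC.sqrt A) = CFC.sqrt A :=
    ((CFC.sqrt_nonneg A).isSelfAdjoint).adjoint_eq
  conv_rhs => rw [← CFC.sqrt_mul_sqrt_self A hA, mul_apply_apply, ← adjoint_inner_left, hs,
    inner_self_eq_norm_sq_to_K]
  norm_cast

/-- A row completion: given `X` with `‖X‖ ≤ d` and a functional on a subspace such that the
column formed by both has norm at most `d` there, the functional extends with the same bound. -/
theorem ContinuousLinearMap.exists_row_extension {X : H →L[ℂ] H} {d : ℝ}
    (hX : ∀ v, ‖X v‖ ^ 2 ≤ d ^ 2 * ‖v‖ ^ 2) (p : Submodule ℂ H) (c : H →L[ℂ] ℂ)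
    (hc : ∀ v ∈ p, ‖X v‖ ^ 2 + ‖c v‖ ^ 2 ≤ d ^ 2 * ‖v‖ ^ 2) :
    ∃ g : H →L[ℂ] ℂ, (∀ v ∈ p, g v = c v) ∧
      ∀ v, ‖X v‖ ^ 2 + ‖g v‖ ^ 2 ≤ d ^ 2 * ‖v‖ ^ 2 := by
  -- With `D = (d² - X* X)^{1/2}` the column bound reads `‖c v‖ ≤ ‖D v‖`: domination by a seminorm,
  -- which Hahn–Banach preserves.
  let A : H →L[ℂ] H := ((d ^ 2 : ℝ) : ℂ) • 1 - adjoint X * X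
  have hAv : ∀ v, ⟪v, A v⟫_ℂ = ((d ^ 2 * ‖v‖ ^ 2 - ‖X v‖ ^ 2 : ℝ) : ℂ) := by
    intro v
    simp [A, adjoint_inner_right, inner_self_eq_norm_sq_to_K]
  have hA : 0 ≤ A := by
    rw [nonneg_iff_isPositive, isPositive_iff_complex]
    intro v
    rw [← inner_conj_symm, hAv, Complex.conj_ofReal]
    refine ⟨by rfl, ?_⟩
    change 0 ≤ d ^ 2 * ‖v‖ ^ 2 - ‖X v‖ ^ 2
    linarith [hX v]
  have hD : ∀ v, ‖CFC.sqrt A v‖ ^ 2 = d ^ 2 * ‖v‖ ^ 2 - ‖X v‖ ^ 2 := fun v => by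
    exact_mod_cast (inner_sqrt_self hA v).trans (hAv v)
  let q : Seminorm ℂ H := (normSeminorm ℂ H).comp (CFC.sqrt A).toLinearMap
  have hq : ∀ v, q v = ‖CFC.sqrt A v‖ := fun v => rfl
  have hqc : Continuous q := (CFC.sqrt A).continuous.norm
  obtain ⟨g, hg, hl⟩ := Module.Dual.exists_continuous_extension_of_le_seminorm p
    ((c : H →ₗ[ℂ] ℂ).domRestrict p) hqc fun x => by
      rw [hq]
      refine abs_le_of_sq_le_sq' ?_ (norm_nonneg _) |>.2
      rw [hD]
      have := hc x x.2
      simp only [LinearMap.domRestrict_apply, coe_coe]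
      linarith
  refine ⟨g, fun v hv => hg ⟨v, hv⟩, fun v => ?_⟩
  have h1 := pow_le_pow_left₀ (norm_nonneg _) (hl v) 2
  rw [hq, hD] at h1
  linarith

end Hilbert

namespace LTV

/-! ### Coordinates in `ℓ²` -/

theorem inner_e (i : ℕ) (x : L2) : ⟪e i, x⟫_ℂ = x i := by simp [e, lp.inner_single_left]

theorem e_apply (i j : ℕ) : e i j = if j = i then 1 else 0 := by
  simp [e, lp.single_apply, Pi.single_apply]

theorem tail_apply (n : ℕ) (x : L2) (j : ℕ) : tail n x j = if j < n then 0 else x j := by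
  have : tail n x j = x j - cut n x j := rfl
  rw [this, cut_apply]; split_ifs <;> simp

theorem enorm_sq_eq_tsum (x : L2) : ‖x‖ₑ ^ 2 = ∑' i, ‖x i‖ₑ ^ 2 := by
  have h := lp.hasSum_norm (p := 2) (by norm_num) x
  norm_num at h
  have h2 := ENNReal.ofReal_tsum_of_nonneg (fun i => sq_nonneg ‖x i‖) h.summable
  rw [h.tsum_eq] at h2
  simpa [ENNReal.ofReal_pow] using h2

theorem norm_sq_le_of_sum_le {x : L2} {C : ℝ}
    (h : ∀ n, ∑ i ∈ Finset.range n, ‖x i‖ ^ 2 ≤ C) : ‖x‖ ^ 2 ≤ C := by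
  have hs := lp.hasSum_norm (p := 2) (by norm_num) x
  norm_num at hs
  exact le_of_tendsto' hs.tendsto_sum_nat h

theorem norm_sq_cut (n : ℕ) (x : L2) : ‖cut n x‖ ^ 2 = ∑ i ∈ Finset.range n, ‖x i‖ ^ 2 := by
  have hs := lp.hasSum_norm (p := 2) (by norm_num) (cut n x)
  norm_num at hs
  rw [← hs.tsum_eq, tsum_eq_sum (s := Finset.range n)]
  · refine Finset.sum_congr rfl fun i hi => ?_
    rw [cut_apply, if_pos (Finset.mem_range.1 hi)]
  · intro i hi
    rw [cut_apply, if_neg (by simpa using hi)]; simp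

theorem norm_cut_le (n : ℕ) (x : L2) : ‖cut n x‖ ≤ ‖x‖ := by
  refine abs_le_of_sq_le_sq' ?_ (norm_nonneg _) |>.2
  have hs := lp.hasSum_norm (p := 2) (by norm_num) x
  norm_num at hs
  rw [norm_sq_cut]
  exact sum_le_hasSum _ (fun i _ => sq_nonneg _) hs

/-! ### Causality and the distance formula -/

theorem cut_mul_tail_of_mem_causal {Q : Op} (hQ : Q ∈ causal) (n : ℕ) :
    cut n * Q * tail n = 0 := by
  rw [tail, mul_sub, hQ n, mul_one, sub_self]

/-- The partial completions used in the distance formula. -/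
structure IsPartialCompletion (B : Op) (d : ℝ) (n : ℕ) (X : Op) : Prop where
  norm_sq_le : ∀ v, ‖X v‖ ^ 2 ≤ d ^ 2 * ‖v‖ ^ 2
  apply_of_le : ∀ v i, n ≤ i → X v i = 0
  apply_of_lt : ∀ v i, i < n → X (tail (i + 1) v) i = B (tail (i + 1) v) i

/-- Only the entries of row `n` right of the diagonal are prescribed. On the range of `tail (n + 1)`
the old rows already agree with `B`, so together with the new one they form the corner `cut (n + 1)
* B * tail (n + 1)`, of norm at most `d`; row completion then applies. -/
theorem IsPartialCompletion.exists_succ {B X : Op} {d : ℝ} {n : ℕ}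
    (hB : ∀ n, ‖cut n * B * tail n‖ ≤ d) (hX : IsPartialCompletion B d n X) :
    ∃ Y, IsPartialCompletion B d (n + 1) Y ∧ ∀ v i, i < n → Y v i = X v i := by
  have hd : 0 ≤ d := (norm_nonneg _).trans (hB 0)
  have hXn : ∀ v, ‖X v‖ ^ 2 = ∑ i ∈ Finset.range n, ‖X v i‖ ^ 2 := by
    intro v
    rw [← norm_sq_cut]
    congr 2
    ext j
    rw [cut_apply]
    split_ifs with h
    · rfl
    · exact hX.apply_of_le v j (not_lt.1 h)
  have htail : ∀ v, ∀ i ≤ n, tail (i + 1) (tail (n + 1) v) = tail (n + 1) v := by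
    intro v i hi
    ext j
    simp only [tail_apply]
    split_ifs <;> first | rfl | omega
  obtain ⟨g, hg, hgX⟩ := ContinuousLinearMap.exists_row_extension hX.norm_sq_le
    (LinearMap.range (tail (n + 1) : L2 →ₗ[ℂ] L2)) ((innerSL ℂ (e n)).comp B) (by
      rintro _ ⟨v, rfl⟩
      have h1 : ∀ i ∈ Finset.range n, X (tail (n + 1) v) i = B (tail (n + 1) v) i := by
        intro i hi
        have := hX.apply_of_lt (tail (n + 1) v) i (Finset.mem_range.1 hi)
        rwa [htail v i (Finset.mem_range.1 hi).le] at this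
      have h2 : ‖X (tail (n + 1) v)‖ ^ 2 + ‖B (tail (n + 1) v) n‖ ^ 2
          = ‖(cut (n + 1) * B * tail (n + 1)) (tail (n + 1) v)‖ ^ 2 := by
        have h3 : (cut (n + 1) * B * tail (n + 1)) (tail (n + 1) v)
            = cut (n + 1) (B (tail (n + 1) v)) := by
          rw [mul_apply_apply, mul_apply_apply, htail v n le_rfl]
        rw [h3, norm_sq_cut, Finset.sum_range_succ, hXn, Finset.sum_congr rfl fun i hi => by
          rw [h1 i hi]]
      simp only [coe_coe, comp_apply, innerSL_apply_apply, inner_e]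
      rw [h2, ← mul_pow]
      gcongr
      exact le_of_opNorm_le _ (hB (n + 1)) _)
  have hY : ∀ v i, (X + g.smulRight (e n)) v i = X v i + if i = n then g v else 0 := by
    intro v i
    have : (X + g.smulRight (e n)) v i = X v i + g v * e n i := rfl
    rw [this, e_apply]; split_ifs <;> simp
  refine ⟨X + g.smulRight (e n), ⟨fun v => ?_, fun v i hi => ?_, fun v i hi => ?_⟩,
    fun v i hi => ?_⟩
  · have : ‖(X + g.smulRight (e n)) v‖ ^ 2 = ‖X v‖ ^ 2 + ‖g v‖ ^ 2 := by
      have h1 : (X + g.smulRight (e n)) v = cut (n + 1) ((X + g.smulRight (e n)) v) := by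
        ext j
        rw [cut_apply]
        split_ifs with h
        · rfl
        · rw [hY, hX.apply_of_le v j (by omega), if_neg (by omega), add_zero]
      rw [h1, norm_sq_cut, Finset.sum_range_succ, hXn]
      congr 1
      · refine Finset.sum_congr rfl fun i hi => ?_
        rw [hY, if_neg (Finset.mem_range.1 hi).ne, add_zero]
      · rw [hY, hX.apply_of_le v n le_rfl, if_pos rfl, zero_add]
    rw [this]
    exact hgX v
  · rw [hY, hX.apply_of_le v i (by omega), if_neg (by omega), add_zero]
  · rw [hY]
    split_ifs with h
    · subst h
      rw [hX.apply_of_le _ _ le_rfl, zero_add]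
      exact (hg _ ⟨v, rfl⟩).trans (inner_e _ _)
    · rw [hX.apply_of_lt v i (by omega), add_zero]
  · rw [hY, if_neg hi.ne, add_zero]

/-- Arveson's distance formula for the nest of `ℓ²`, with attainment. -/
theorem exists_mem_causal_norm_sub_le {B : Op} {d : ℝ} (hB : ∀ n, ‖cut n * B * tail n‖ ≤ d) :
    ∃ Q ∈ causal, ‖B - Q‖ ≤ d := by
  have hd : 0 ≤ d := (norm_nonneg _).trans (hB 0)
  have h0 : IsPartialCompletion B d 0 0 :=
    ⟨fun v => by simp; positivity, fun v i _ => rfl, fun v i hi => by omega⟩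
  -- Row `i` is frozen from stage `i + 1` on, so the limit operator `Y` reads it off `Z (i + 1)`.
  let Z : (n : ℕ) → {X : Op // IsPartialCompletion B d n X} := fun n =>
    Nat.rec ⟨0, h0⟩ (fun _ X => ⟨_, (X.2.exists_succ hB).choose_spec.1⟩) n
  have hZ : ∀ n v i, i < n → (Z (n + 1)).1 v i = (Z n).1 v i := fun n =>
    ((Z n).2.exists_succ hB).choose_spec.2
  have hZ' : ∀ n v i, i < n → (Z (i + 1)).1 v i = (Z n).1 v i := by
    intro n v i hi
    induction n, hi using Nat.le_induction with
    | base => rfl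
    | succ m hm ih => rw [ih, hZ m v i hm]
  have hsum : ∀ v n, ∑ i ∈ Finset.range n, ‖(Z (i + 1)).1 v i‖ ^ 2 ≤ d ^ 2 * ‖v‖ ^ 2 := by
    intro v n
    calc _ = ‖cut n ((Z n).1 v)‖ ^ 2 := by
          rw [norm_sq_cut]
          exact Finset.sum_congr rfl fun i hi => by rw [hZ' n v i (Finset.mem_range.1 hi)]
      _ ≤ ‖(Z n).1 v‖ ^ 2 := by gcongr; exact norm_cut_le _ _
      _ ≤ _ := (Z n).2.norm_sq_le v
  have hmem : ∀ v, Memℓp (fun i => (Z (i + 1)).1 v i) 2 := by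
    intro v
    apply memℓp_gen
    norm_num
    exact summable_of_sum_range_le (fun _ => sq_nonneg _) (hsum v)
  let Y₀ : L2 →ₗ[ℂ] L2 :=
    { toFun := fun v => ⟨fun i => (Z (i + 1)).1 v i, hmem v⟩
      map_add' := fun v w => by
        ext i
        have h := congrArg (fun x : L2 => x i) (map_add (Z (i + 1)).1 v w)
        exact h
      map_smul' := fun c v => by
        ext i
        have h := congrArg (fun x : L2 => x i) (map_smul (Z (i + 1)).1 c v)
        exact h }
  have hY₀ : ∀ v, ‖Y₀ v‖ ≤ d * ‖v‖ := fun v =>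
    abs_le_of_sq_le_sq' (by
      rw [mul_pow]
      exact norm_sq_le_of_sum_le (hsum v)) (by positivity) |>.2
  let Y : Op := Y₀.mkContinuous d hY₀
  -- `Y` agrees with `B` strictly above the diagonal, so `B - Y` is causal, at distance `‖Y‖ ≤ d`
  -- from `B`.
  refine ⟨B - Y, fun n => ?_, ?_⟩
  · have key : cut n * (B - Y) * tail n = 0 := by
      ext v i
      rw [mul_apply_apply, mul_apply_apply, cut_apply]
      split_ifs with hi
      · have h1 : (Z (i + 1)).1 (tail n v) i = B (tail n v) i := by
          have h2 : tail (i + 1) (tail n v) = tail n v := by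
            ext j
            simp only [tail_apply]
            split_ifs <;> first | rfl | omega
          have := (Z (i + 1)).2.apply_of_lt (tail n v) i (Nat.lt_succ_self i)
          rwa [h2] at this
        change B (tail n v) i - (Z (i + 1)).1 (tail n v) i = 0
        rw [h1, sub_self]
      · rfl
    rw [tail, mul_sub, mul_one, sub_eq_zero] at key
    exact key.symm
  · rw [sub_sub_cancel]
    exact Y₀.mkContinuous_norm_le hd hY₀

/-! ### Hilbert–Schmidt and trace norm estimates -/

/-- The square of the Hilbert–Schmidt norm. -/
noncomputable def hsSq (A : Op) : ℝ≥0∞ := ∑' i, ‖A (e i)‖ₑ ^ 2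

theorem hsSq_adjoint (A : Op) : hsSq (adjoint A) = hsSq A := by
  simp only [hsSq, enorm_sq_eq_tsum]
  rw [ENNReal.tsum_comm]
  refine tsum_congr fun i => tsum_congr fun j => ?_
  rw [← inner_e, ← inner_e, adjoint_inner_right, ← ofReal_norm, ← ofReal_norm,
    norm_inner_symm]

theorem hsSq_mul_le_left (A C : Op) : hsSq (A * C) ≤ ‖A‖ₑ ^ 2 * hsSq C := by
  simp only [hsSq]
  rw [← ENNReal.tsum_mul_left]
  refine ENNReal.tsum_le_tsum fun i => ?_
  rw [← mul_pow]
  gcongr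
  exact le_opENorm A _

theorem hsSq_mul_le_right (A C : Op) : hsSq (A * C) ≤ ‖C‖ₑ ^ 2 * hsSq A := by
  rw [← hsSq_adjoint, ← hsSq_adjoint A]
  refine (le_of_eq ?_).trans ((hsSq_mul_le_left (adjoint C) (adjoint A)).trans (le_of_eq ?_))
  · congr 1
    exact star_mul A C
  · congr 2
    exact enorm_eq_iff_norm_eq.2 (LinearIsometryEquiv.norm_map _ _)

theorem tsum_enorm_inner_le (A C : Op) :
    ∑' i, ‖⟪A (e i), C (e i)⟫_ℂ‖ₑ ≤ hsSq A ^ (1 / 2 : ℝ) * hsSq C ^ (1 / 2 : ℝ) := by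
  rw [ENNReal.tsum_eq_iSup_sum]
  refine iSup_le fun s => ?_
  have h := ENNReal.inner_le_Lp_mul_Lq s (fun i => ‖A (e i)‖ₑ) (fun i => ‖C (e i)‖ₑ)
    (p := 2) (q := 2) Real.HolderConjugate.two_two
  refine (Finset.sum_le_sum fun i _ => ?_).trans (h.trans ?_)
  · simp only [← ofReal_norm]
    rw [← ENNReal.ofReal_mul (norm_nonneg _)]
    exact ENNReal.ofReal_le_ofReal (norm_inner_le_norm _ _)
  · simp only [ENNReal.rpow_ofNat]
    gcongr <;> exact ENNReal.sum_le_tsum _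

section Modulus

variable {H : Type*} [NormedAddCommGroup H] [InnerProductSpace ℂ H] [CompleteSpace H]

theorem modulus_nonneg (T : H →L[ℂ] H) : 0 ≤ modulus T := CFC.sqrt_nonneg _

theorem norm_modulus_apply (T : H →L[ℂ] H) (x : H) : ‖modulus T x‖ = ‖T x‖ := by
  have h : 0 ≤ adjoint T * T := star_mul_self_nonneg T
  have h1 := inner_sqrt_self h x
  rw [mul_apply_apply, adjoint_inner_right, inner_self_eq_norm_sq_to_K] at h1
  have h2 : ‖CFC.sqrt (adjoint T * T) x‖ ^ 2 = ‖T x‖ ^ 2 :=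
    Complex.ofReal_injective (h1.trans (Complex.ofReal_pow _ _).symm)
  exact (sq_eq_sq₀ (norm_nonneg _) (norm_nonneg _)).1 h2

theorem exists_mul_self_eq_modulus (T : H →L[ℂ] H) :
    ∃ R : H →L[ℂ] H, R * R = modulus T ∧ ∀ x, (⟪x, modulus T x⟫_ℂ).re = ‖R x‖ ^ 2 :=
  ⟨CFC.sqrt (modulus T), CFC.sqrt_mul_sqrt_self _ (modulus_nonneg T), fun x => by
    rw [← inner_sqrt_self (modulus_nonneg T), Complex.ofReal_re]⟩

end Modulus

/-- Factor `T = V R R` with `R = |T|^{1/2}` and `V` a contraction. Each term pairs `(V R)* eᵢ` with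
`R B eᵢ`, and Cauchy–Schwarz applies since `hsSq R` is the trace norm of `T`. -/
theorem tsum_enorm_inner_mul_le (T B : Op) :
    ∑' i, ‖⟪e i, (T * B) (e i)⟫_ℂ‖ₑ ≤ traceNorm T * ‖B‖ₑ := by
  obtain ⟨R, hRR, hRn⟩ := exists_mul_self_eq_modulus T
  have hRT : traceNorm T = hsSq R := tsum_congr fun i => by
    rw [hRn, ENNReal.ofReal_pow (norm_nonneg _), ofReal_norm]
  obtain ⟨V, hV, hVT⟩ := exists_contraction_mul_eq fun x => (norm_modulus_apply T x).ge
  have hfac : ∀ x, ⟪x, (T * B) x⟫_ℂ = ⟪adjoint (V * R) x, (R * B) x⟫_ℂ := by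
    intro x
    rw [adjoint_inner_left, ← hVT, ← hRR]
    rfl
  have h1 : hsSq (adjoint (V * R)) ≤ traceNorm T := by
    rw [hsSq_adjoint, hRT]
    refine (hsSq_mul_le_left V R).trans ?_
    have : ‖V‖ₑ ≤ 1 := by
      rw [← ofReal_norm]
      exact ENNReal.ofReal_le_one.2 hV
    calc ‖V‖ₑ ^ 2 * hsSq R ≤ 1 ^ 2 * hsSq R := by gcongr
      _ = _ := by simp
  have h2 : hsSq (R * B) ≤ ‖B‖ₑ ^ 2 * traceNorm T := by
    rw [hRT]
    exact hsSq_mul_le_right R B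
  calc _ = ∑' i, ‖⟪adjoint (V * R) (e i), (R * B) (e i)⟫_ℂ‖ₑ := by simp only [hfac]
    _ ≤ _ := tsum_enorm_inner_le _ _
    _ ≤ traceNorm T ^ (1 / 2 : ℝ) * (‖B‖ₑ ^ 2 * traceNorm T) ^ (1 / 2 : ℝ) := by gcongr
    _ = traceNorm T * ‖B‖ₑ := by
      rw [ENNReal.mul_rpow_of_nonneg _ _ (by norm_num), mul_left_comm,
        ← ENNReal.rpow_add_of_nonneg _ _ (by norm_num) (by norm_num), ← ENNReal.rpow_ofNat,
        ← ENNReal.rpow_mul]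
      norm_num
      exact mul_comm _ _

theorem summable_inner_mul {T : Op} (hT : T ∈ traceClass) (B : Op) :
    Summable fun i => ⟪e i, (T * B) (e i)⟫_ℂ := by
  refine Summable.of_enorm ?_
  exact ((tsum_enorm_inner_mul_le T B).trans_lt (ENNReal.mul_lt_top hT enorm_lt_top)).ne

theorem norm_tr_mul_le {T : Op} (hT : traceNorm T ≤ 1) (B : Op) : ‖tr (T * B)‖ ≤ ‖B‖ := by
  have h : ‖tr (T * B)‖ₑ ≤ ‖B‖ₑ := by
    refine enorm_tsum_le_tsum_enorm.trans ((tsum_enorm_inner_mul_le T B).trans ?_)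
    calc traceNorm T * ‖B‖ₑ ≤ 1 * ‖B‖ₑ := by gcongr
      _ = _ := one_mul _
  exact enorm_le_iff_norm_le.1 h

/-! ### The pairing of `S` with causal operators -/

/-- Causality puts `Q eᵢ` in the range of `tail i`, where row `i` of `T` vanishes. -/
theorem inner_mul_eq_zero {T Q : Op} (hT : T ∈ S) (hQ : Q ∈ causal) (i : ℕ) :
    ⟪e i, (T * Q) (e i)⟫_ℂ = 0 := by
  have h1 : Q (e i) = tail i (Q (e i)) := by
    ext j
    rw [tail_apply]
    split_ifs with hj
    · have h := DFunLike.congr_fun (cut_mul_tail_of_mem_causal hQ i) (e i)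
      have h2 : tail i (e i) = e i := by
        ext k
        rw [tail_apply, e_apply]
        split_ifs <;> first | rfl | omega
      rw [mul_apply_apply, mul_apply_apply, h2] at h
      have h3 := congrArg (fun x : L2 => x j) h
      simpa [cut_apply, hj] using h3
    · rfl
  have h := congrArg (fun x : L2 => x i) (DFunLike.congr_fun (hT.2 i) (Q (e i)))
  simp only [mul_apply_apply] at h
  rw [cut_apply, if_pos (Nat.lt_succ_self i), ← h1] at h
  rw [inner_e]
  exact h

theorem tr_mul_sub {T Q : Op} (hT : T ∈ S) (hQ : Q ∈ causal) (B : Op) :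
    tr (T * (B - Q)) = tr (T * B) := by
  refine tsum_congr fun i => ?_
  have : (T * (B - Q)) (e i) = (T * B) (e i) - (T * Q) (e i) := by rw [mul_sub]; rfl
  rw [this, inner_sub_right, inner_mul_eq_zero hT hQ, sub_zero]

/-! ### Rank one test operators -/

theorem modulus_rankOne {u v : L2} (hu : ‖u‖ = 1) (hv : ‖v‖ = 1) :
    modulus (InnerProductSpace.rankOne ℂ u v) = InnerProductSpace.rankOne ℂ v v := by
  refine CFC.sqrt_unique ?_ ?_
  · ext1 x
    refine ext_inner_left ℂ fun y => ?_
    rw [mul_apply_apply, mul_apply_apply, adjoint_inner_right]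
    simp [InnerProductSpace.rankOne_apply, inner_smul_left, inner_smul_right,
      inner_self_eq_norm_sq_to_K, hu, hv]
  · rw [nonneg_iff_isPositive]
    exact InnerProductSpace.isPositive_rankOne_self v

theorem traceNorm_rankOne {u v : L2} (hu : ‖u‖ = 1) (hv : ‖v‖ = 1) :
    traceNorm (InnerProductSpace.rankOne ℂ u v) = 1 := by
  have h := enorm_sq_eq_tsum v
  have hv' : ‖v‖ₑ = 1 := by rw [← ofReal_norm, hv, ENNReal.ofReal_one]
  rw [hv', one_pow] at h
  rw [traceNorm, modulus_rankOne hu hv, h]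
  refine tsum_congr fun i => ?_
  rw [InnerProductSpace.rankOne_apply, inner_smul_right, inner_e, ← inner_conj_symm, inner_e,
    ← Complex.normSq_eq_conj_mul_self, Complex.ofReal_re, Complex.normSq_eq_norm_sq,
    ENNReal.ofReal_pow (norm_nonneg _), ofReal_norm]

theorem tr_rankOne_mul (u v : L2) (B : Op) :
    tr (InnerProductSpace.rankOne ℂ u v * B) = ⟪v, B u⟫_ℂ := by
  rw [tr, ← adjoint_inner_left, lp.inner_eq_tsum]
  refine tsum_congr fun i => ?_
  rw [mul_apply_apply, InnerProductSpace.rankOne_apply, inner_smul_right, inner_e,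
    ← adjoint_inner_left, ← inner_conj_symm, inner_e]
  simp [mul_comm]

/-- For `m < n`, `cut (m + 1)` kills `u`; for `m ≥ n`, `v` is orthogonal to the range of `tail m`.
-/
theorem rankOne_mem_S {u v : L2} (hu : ‖u‖ = 1) (hv : ‖v‖ = 1) {n : ℕ}
    (hun : tail n u = u) (hvn : cut n v = v) : InnerProductSpace.rankOne ℂ u v ∈ S := by
  refine ⟨by rw [traceClass, Set.mem_ofPred_eq, traceNorm_rankOne hu hv]; exact ENNReal.one_lt_top,
    fun m => ?_⟩
  ext x i
  rw [mul_apply_apply, mul_apply_apply, InnerProductSpace.rankOne_apply, map_smul]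
  change ⟪v, tail m x⟫_ℂ * cut (m + 1) u i = 0
  rcases lt_or_ge m n with h | h
  · rw [← hun, cut_apply, tail_apply]
    split_ifs <;> first | omega | simp
  · have : ⟪v, tail m x⟫_ℂ = 0 := by
      rw [lp.inner_eq_tsum]
      refine (tsum_congr fun j => ?_).trans tsum_zero
      rw [← hvn, cut_apply, tail_apply]
      split_ifs <;> first | omega | simp
    rw [this, zero_mul]

theorem norm_cut_mul_tail_le {B : Op} {b : ℝ}
    (hb : ∀ T ∈ S, traceNorm T ≤ 1 → ‖tr (T * B)‖ ≤ b) (n : ℕ) :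
    ‖cut n * B * tail n‖ ≤ b := by
  have hb0 : 0 ≤ b := by
    have h0 : traceNorm (0 : Op) = 0 := by
      have : modulus (0 : Op) = 0 := by simp [modulus]
      simp [traceNorm, this]
    refine (norm_nonneg _).trans (hb 0 ⟨?_, fun n => by simp⟩ (by simp [h0]))
    rw [traceClass, Set.mem_ofPred_eq, h0]
    exact ENNReal.zero_lt_top
  have htt : ∀ x, tail n (tail n x) = tail n x := fun x => by
    ext j
    simp only [tail_apply]
    split_ifs <;> rfl
  have hcc : ∀ x, cut n (cut n x) = cut n x := fun x => by
    ext j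
    simp only [cut_apply]
    split_ifs <;> rfl
  have hcs : ∀ x y, ⟪cut n x, y⟫_ℂ = ⟪x, cut n y⟫_ℂ := fun x y => by
    rw [lp.inner_eq_tsum, lp.inner_eq_tsum]
    refine tsum_congr fun j => ?_
    rw [cut_apply, cut_apply]
    split_ifs <;> simp
  have htn : ∀ x, ‖tail n x‖ ≤ ‖x‖ := fun x => by
    refine lp.norm_mono (by norm_num) fun i => ?_
    rw [tail_apply]
    split_ifs <;> simp
  refine opNorm_le_bound _ hb0 fun x => ?_
  set u := tail n x with hu
  set w := cut n (B u) with hw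
  have hval : (cut n * B * tail n) x = w := rfl
  rw [hval]
  rcases eq_or_ne u 0 with hu0 | hu0
  · rw [hw, hu0, map_zero, map_zero, norm_zero]; positivity
  rcases eq_or_ne w 0 with hw0 | hw0
  · rw [hw0, norm_zero]; positivity
  have hun := norm_pos_iff.2 hu0
  have hwn := norm_pos_iff.2 hw0
  have h1 : ‖((‖u‖ : ℂ)⁻¹) • u‖ = 1 := norm_smul_inv_norm hu0
  have h2 : ‖((‖w‖ : ℂ)⁻¹) • w‖ = 1 := norm_smul_inv_norm hw0
  -- The normalized test pair gives the dual value `‖w‖ / ‖u‖`.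
  have h := hb _ (rankOne_mem_S (n := n) h1 h2 (by rw [map_smul, hu, htt])
    (by rw [map_smul, hw, hcc])) (traceNorm_rankOne h1 h2).le
  have h3 : ⟪w, B u⟫_ℂ = (‖w‖ : ℂ) ^ 2 := by
    have hww : cut n w = w := hcc _
    rw [← hww, hcs, ← hw, hww, inner_self_eq_norm_sq_to_K]; rfl
  rw [tr_rankOne_mul, map_smul, inner_smul_left, inner_smul_right, h3, norm_mul, norm_mul] at h
  simp only [map_inv₀, Complex.conj_ofReal, norm_inv, norm_pow, Complex.norm_real, norm_norm] at h
  have h4 : ‖w‖ ≤ b * ‖u‖ := by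
    have : ‖w‖⁻¹ * (‖u‖⁻¹ * ‖w‖ ^ 2) = ‖w‖ / ‖u‖ := by field_simp
    rw [this, div_le_iff₀ hun] at h
    exact h
  exact h4.trans (by gcongr; exact htn x)

end LTV

theorem theorem1
    (T₁ T₂ T₃ T₂ᵢ T₂ₒ T₃ₒ T₃cᵢ : LTV.Op)
    -- the causal data and the inner-outer and outer-inner factorizations
    (hT₁ : T₁ ∈ LTV.causal) (hT₂ : T₂ ∈ LTV.causal) (hT₃ : T₃ ∈ LTV.causal)
    (hfac₂ : T₂ = T₂ᵢ * T₂ₒ) (hin₂ : LTV.IsInner T₂ᵢ) (hout₂ : LTV.IsOuter T₂ₒ)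
    (hfac₃ : T₃ = T₃ₒ * T₃cᵢ) (hin₃ : LTV.IsInner T₃cᵢ ∨ LTV.IsCoinner T₃cᵢ)
    (hout₃ : LTV.IsOuter T₃ₒ)
    -- the outer factors are invertible in the algebra of causal operators
    (hA₂ : LTV.IsCausallyInvertible T₂ₒ) (hA₃ : LTV.IsCausallyInvertible T₃ₒ)
    (B : LTV.Op)
    (hB : B = ContinuousLinearMap.adjoint T₂ᵢ * T₁ * ContinuousLinearMap.adjoint T₃cᵢ)
    (μ : ℝ) (hμ : μ = ⨅ Q : LTV.causal, ‖B - (Q : LTV.Op)‖) :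
    -- the infimum is attained
    (∃ Qₒ ∈ LTV.causal, ‖B - Qₒ‖ = μ) ∧
    -- the traces in the dual problem converge absolutely, and their supremum is the infimum
    (∀ T ∈ LTV.S, Summable fun i : ℕ => inner ℂ (LTV.e i) ((T * B) (LTV.e i))) ∧
    IsLUB {r : ℝ | ∃ T ∈ LTV.S, LTV.traceNorm T ≤ 1 ∧ r = ‖LTV.tr (T * B)‖} μ := by
  have hbdd : BddBelow (Set.range fun Q : LTV.causal => ‖B - (Q : LTV.Op)‖) :=
    ⟨0, by rintro _ ⟨Q, rfl⟩; exact norm_nonneg _⟩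
  have hle : ∀ Q ∈ LTV.causal, μ ≤ ‖B - Q‖ := fun Q hQ => hμ ▸ ciInf_le hbdd ⟨Q, hQ⟩
  have : Nonempty LTV.causal := ⟨⟨T₁, hT₁⟩⟩
  have hub : ∀ T ∈ LTV.S, LTV.traceNorm T ≤ 1 → ‖LTV.tr (T * B)‖ ≤ μ := fun T hT hT1 => by
    rw [hμ]
    refine le_ciInf fun Q => ?_
    rw [← LTV.tr_mul_sub hT Q.2 B]
    exact LTV.norm_tr_mul_le hT1 _
  refine ⟨?_, fun T hT => LTV.summable_inner_mul hT.1 B, ?_, fun b hb => ?_⟩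
  · obtain ⟨Q, hQ, hQB⟩ := LTV.exists_mem_causal_norm_sub_le (LTV.norm_cut_mul_tail_le hub)
    exact ⟨Q, hQ, le_antisymm hQB (hle Q hQ)⟩
  · rintro _ ⟨T, hT, hT1, rfl⟩
    exact hub T hT hT1
  -- The distance formula with an arbitrary upper bound `b` in place of `μ` yields `μ ≤ b`.
  · obtain ⟨Q, hQ, hQB⟩ := LTV.exists_mem_causal_norm_sub_le
      (LTV.norm_cut_mul_tail_le fun T hT hT1 => hb ⟨T, hT, hT1, rfl⟩)
    exact (hle Q hQ).trans hQB
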